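/- Let $G$ be a finite group, $p$ a prime, and $P$ a Sylow $p$-subgroup of $G$. Let $Z_{p-1}(P)$ denote the $(p-1)$-th term of the upper central series of $P$ (with $Z_0(P)=1$ and $Z_1(P)=Z(P)$). For a Sylow $p$-subgroup $Q$ of $G$, the intersection $P\cap Q$ is called tame if $N_P(P\cap Q)$ and $N_Q(P\cap Q)$ are both Sylow $p$-subgroups of $N_G(P\cap Q)$. A finite group is called $p$-nilpotent if it has a normal Hall $p'$-subgroup, i.e. a normal subgroup of order prime to $p$ and of index a power of $p$. For a finite group $H$, let $A^p(H)$ be the smallest normal subgroup of $H$ whose quotient is an abelian $p$-group. A subgroup $N\le G$ of index prime to $p$ is said to control $p$-transfer in $G$ if $N/A^p(N)\cong G/A^p(G)$. Suppose that, for every Sylow $p$-subgroup $Q$ of $G$ such that $P\cap Q$ is a tame intersection and $Z_{p-1}(P)<P\cap Q<P$ (both inclusions proper), the group $N_G(P\cap Q)$ is $p$-nilpotent. Then $N_G(P)$ controls $p$-transfer in $G$. -/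

import Mathlib

namespace PTransfer

/-- A group is `p`-nilpotent if it has a normal Hall `p'`-subgroup: a normal subgroup whose order
is prime to `p` and whose index is a power of `p`. -/
def IsPNilpotent (p : ℕ) (G : Type*) [Group G] : Prop :=
  ∃ K : Subgroup G, K.Normal ∧ (Nat.card K).Coprime p ∧ ∃ n : ℕ, K.index = p ^ n

/-- `K` is normal in `G` and `G ⧸ K` is an abelian `p`-group. -/
def HasAbelianPQuotient (p : ℕ) {G : Type*} [Group G] (K : Subgroup G) : Prop :=
  ∃ _ : K.Normal, IsPGroup p (G ⧸ K) ∧ IsMulCommutative (G ⧸ K)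

/-- `A^p(G)`, the intersection of all normal subgroups of `G` whose quotient is an abelian
`p`-group; for finite `G` it is the smallest such subgroup. -/
def abelianPResidual (p : ℕ) (G : Type*) [Group G] : Subgroup G :=
  sInf {K : Subgroup G | HasAbelianPQuotient p K}

instance abelianPResidual_normal (p : ℕ) (G : Type*) [Group G] :
    (abelianPResidual p G).Normal where
  conj_mem x hx g := by
    unfold abelianPResidual at hx ⊢
    rw [Subgroup.mem_sInf] at hx ⊢
    intro K hK
    obtain ⟨hn, -⟩ := id hK
    exact hn.conj_mem x (hx K hK) g

/-- `N ≤ G` controls `p`-transfer in `G`: its index is prime to `p` and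
`N / A^p(N) ≅ G / A^p(G)`. -/
def ControlsPTransfer (p : ℕ) {G : Type*} [Group G] (N : Subgroup G) : Prop :=
  N.index.Coprime p ∧
    Nonempty ((N ⧸ abelianPResidual p N) ≃* (G ⧸ abelianPResidual p G))

/-- The subgroup `S` is (contained in and) a Sylow `p`-subgroup of the subgroup `H`. -/
def IsSylowIn (p : ℕ) {G : Type*} [Group G] (S H : Subgroup G) : Prop :=
  S ≤ H ∧ ∃ T : Sylow p H, (T : Subgroup H) = S.subgroupOf H

/-- `P ∩ Q` is a tame intersection: `N_P(P ∩ Q)` and `N_Q(P ∩ Q)` are both Sylow `p`-subgroups of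
`N_G(P ∩ Q)`. -/
def IsTameIntersection {p : ℕ} {G : Type*} [Group G] (P Q : Sylow p G) : Prop :=
  let N : Subgroup G := Subgroup.normalizer ((P ⊓ Q : Subgroup G) : Set G)
  IsSylowIn p ((P : Subgroup G) ⊓ N) N ∧ IsSylowIn p ((Q : Subgroup G) ⊓ N) N

end PTransfer

/-!
Write `N = N_G(P)`. Since `N` has index prime to `p`, the natural map `N / A^p(N) → G / A^p(G)` is
onto, and it is an isomorphism as soon as the transfer `G → N / A^p(N)` is onto
(`PTransfer.controlsPTransfer_of_surjective`). If the transfer is not onto, there is a nontrivial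
homomorphism `φ : N → A` to an abelian group of exponent `p` whose transfer is trivial, and this is
refuted by `Sylow.exists_transfer_ne_one`, as follows.

Choose `u ∈ P` of least order with `φ u ≠ 1`. Proper powers of `u` then contribute nothing to the
transfer, which becomes the product of `φ (g⁻¹ u g)` over the cosets `g N` fixed by `u`
(`MonoidHom.transfer_eq_prod_conjExtendQuot`). The coset `N` contributes `φ u ≠ 1`, so it is enough
that the remaining `P`-orbits on `G / N` contribute `1` each. The stabilizer of `g N` in `P` is `R =
P ∩ g P g⁻¹`, a proper subgroup of `P`. If `x ∈ N_P(R)` has order `p` modulo `R`, then the fixed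
cosets in the orbit are grouped into cycles of length `p` by `s g N ↦ s x g N`, and the product over
a cycle is a value of the norm `1 + T + ⋯ + T ^ (p - 1)` of the homomorphism `r ↦ φ (g⁻¹ r g)` on
`R`, where `T` is induced by conjugation by `x`. In characteristic `p` this norm is `(T - 1) ^ (p -
1)`.

* If `Z_{p-1}(P)` is not properly contained in `R`, a suitable `x` satisfies `[R, x, …, x] = 1` with
  `p - 1` commutators, so the norm vanishes (`IsPGroup.exists_normalizer_iterate_twistDiff_eq_one`).
* If `Z_{p-1}(P) < R`, an induction in the style of Alperin's fusion theorem
  (`Sylow.exists_centralizer_smul_eq`) uses the `p`-nilpotency of the normalizers of tame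
  intersections to show that `g P g⁻¹ = c P c⁻¹` for some `c` centralizing `R`. Then `φ (g⁻¹ r g) =
  φ r` on `R`; this is invariant under conjugation by `P`, and its norm is its `p`-th power, which
  is trivial.
-/

/-! ### Products over cycles of prime length -/

open Finset in
/-- The hypotheses on `σ` make all its cycles have length `p`, so the product splits into products
over these cycles. -/
theorem Equiv.Perm.prod_eq_one_of_prod_pow_eq_one {X A : Type*} [Fintype X] [CommMonoid A] {p : ℕ}
    [hp : Fact p.Prime] (σ : Equiv.Perm X) (hσ : σ ^ p = 1) (hfix : ∀ x, σ x ≠ x) (f : X → A)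
    (hf : ∀ x, ∏ i ∈ range p, f ((σ ^ i) x) = 1) : ∏ x, f x = 1 := by
  classical
  refine Finset.prod_cancels_of_partition_cancels (Equiv.Perm.SameCycle.setoid σ) fun x _ => ?_
  have hper : Function.minimalPeriod σ x = p := by
    refine Function.minimalPeriod_eq_prime (hp := hp) ?_ ?_
    · change σ^[p] x = x
      rw [Equiv.Perm.iterate_eq_pow, hσ]; rfl
    · exact hfix x
  rw [← hf x]
  symm
  refine Finset.prod_bij (fun i _ => (σ ^ i) x) ?_ ?_ ?_ ?_
  · intro i _
    simp only [mem_filter, mem_univ, true_and]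
    exact (Equiv.Perm.SameCycle.symm ⟨i, by simp⟩ : σ.SameCycle ((σ ^ i) x) x)
  · intro i hi j hj hij
    simp only [← Equiv.Perm.iterate_eq_pow] at hij
    have := Function.iterate_eq_iterate_iff_of_lt_minimalPeriod (f := σ) (x := x)
      (by rw [hper]; simpa using hi) (by rw [hper]; simpa using hj)
    exact this.1 hij
  · intro y hy
    simp only [mem_filter, mem_univ, true_and] at hy
    obtain ⟨k, -, hk, rfl⟩ := (Equiv.Perm.SameCycle.symm hy : σ.SameCycle x y).exists_pow_eq''
    refine ⟨k % p, by simpa using Nat.mod_lt _ hp.out.pos, ?_⟩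
    conv_rhs => rw [← Nat.mod_add_div k p, pow_add, pow_mul, hσ, one_pow, mul_one]
  · intro _ _; rfl

open Finset in
/-- Right multiplication by `x` is a well-defined permutation `s R ↦ s x R` of the left cosets of
`R`, all of whose cycles have length `p`. A product over `Γ ⧸ R` is therefore trivial as soon as the
product over each cycle is. -/
theorem Subgroup.prod_quotient_eq_one_of_mem_normalizer {Γ A : Type*} [Group Γ] [CommMonoid A]
    {p : ℕ} [Fact p.Prime] (R : Subgroup Γ) [Fintype (Γ ⧸ R)] {x : Γ}
    (hx : x ∈ Subgroup.normalizer (R : Set Γ)) (hxR : x ∉ R) (hxp : x ^ p ∈ R) (f : Γ ⧸ R → A)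
    (hf : ∀ s : Γ, ∏ i ∈ range p, f ((s * x ^ i : Γ) : Γ ⧸ R) = 1) : ∏ y, f y = 1 := by
  have key : ∀ y ∈ Subgroup.normalizer (R : Set Γ), ∀ a b : Γ,
      QuotientGroup.leftRel R a b → QuotientGroup.leftRel R (a * y) (b * y) := by
    intro y hy a b hab
    rw [QuotientGroup.leftRel_apply] at hab ⊢
    have := (Subgroup.mem_normalizer_iff''.1 hy _).1 hab
    simpa [mul_assoc] using this
  let σ : Equiv.Perm (Γ ⧸ R) :=
    { toFun := Quotient.map' (· * x) (key x hx)
      invFun := Quotient.map' (· * x⁻¹) (key x⁻¹ (inv_mem hx))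
      left_inv := by
        intro y
        induction y using QuotientGroup.induction_on with | H s => ?_
        change ((s * x * x⁻¹ : Γ) : Γ ⧸ R) = s
        simp
      right_inv := by
        intro y
        induction y using QuotientGroup.induction_on with | H s => ?_
        change ((s * x⁻¹ * x : Γ) : Γ ⧸ R) = s
        simp }
  have hσ : ∀ (i : ℕ) (s : Γ), (σ ^ i) (s : Γ ⧸ R) = ((s * x ^ i : Γ) : Γ ⧸ R) := by
    intro i
    induction i with
    | zero => intro s; simp
    | succ i ih =>
      intro s
      rw [pow_succ, Equiv.Perm.mul_apply, show σ (s : Γ ⧸ R) = ((s * x : Γ) : Γ ⧸ R) from rfl, ih,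
        pow_succ', mul_assoc]
  refine Equiv.Perm.prod_eq_one_of_prod_pow_eq_one (p := p) σ ?_ ?_ f ?_
  · ext y
    induction y using QuotientGroup.induction_on with | H s => ?_
    rw [hσ, Equiv.Perm.one_apply, eq_comm, QuotientGroup.eq]
    simpa using hxp
  · intro y
    induction y using QuotientGroup.induction_on with | H s => ?_
    have := hσ 1 s
    rw [pow_one, pow_one] at this
    rw [this, ne_comm, ne_eq, QuotientGroup.eq]
    simpa using hxR
  · intro y
    induction y using QuotientGroup.induction_on with | H s => ?_
    simpa only [hσ] using hf s

/-! ### The norm of an automorphism as an iterated difference -/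

theorem Polynomial.geom_sum_X_eq_sub_one_pow (p : ℕ) [hp : Fact p.Prime] :
    ∑ i ∈ Finset.range p, (Polynomial.X : Polynomial (ZMod p)) ^ i =
      (Polynomial.X - 1) ^ (p - 1) := by
  have h0 : (Polynomial.X - 1 : Polynomial (ZMod p)) ≠ 0 := by
    simpa using Polynomial.X_sub_C_ne_zero (1 : ZMod p)
  apply mul_right_cancel₀ h0
  rw [geom_sum_mul, ← pow_succ, Nat.sub_add_cancel hp.out.one_le, sub_pow_char, one_pow]

/-- The difference `μ ∘ α / μ`, that is, `α* - 1` applied to `μ` when the group of homomorphisms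
`R →* A` is written additively. -/
def MonoidHom.twistDiff {R A : Type*} [Group R] [CommGroup A] (α : R →* R) (μ : R →* A) : R →* A :=
  μ.comp α / μ

theorem MonoidHom.twistDiff_apply {R A : Type*} [Group R] [CommGroup A] (α : R →* R) (μ : R →* A)
    (r : R) : MonoidHom.twistDiff α μ r = μ (α r * r⁻¹) := by
  simp [MonoidHom.twistDiff, div_eq_mul_inv]

/-- Over `ZMod p` the identity `1 + T + ⋯ + T ^ (p - 1) = (T - 1) ^ (p - 1)` holds. -/
theorem LinearMap.sum_iterate_eq_iterate_sub_self {E : Type*} [AddCommGroup E] {p : ℕ}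
    [hp : Fact p.Prime] [Module (ZMod p) E] (T : Module.End (ZMod p) E) (e : E) :
    ∑ i ∈ Finset.range p, T^[i] e = (fun e => T e - e)^[p - 1] e := by
  have h2 : ∀ (i : ℕ) (e : E), ((T - 1) ^ i) e = (fun e => T e - e)^[i] e :=
    fun i e => Module.End.pow_apply (T - 1) i e
  have key := congrArg (Polynomial.aeval T) (Polynomial.geom_sum_X_eq_sub_one_pow p)
  simp only [map_sum, map_pow, map_sub, Polynomial.aeval_X, map_one] at key
  simpa only [LinearMap.sum_apply, Module.End.pow_apply, h2] using
    congrArg (fun S : Module.End (ZMod p) E => S e) key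

theorem AddMonoidHom.sum_iterate_eq_iterate_sub_self {E : Type*} [AddCommGroup E] {p : ℕ}
    [hp : Fact p.Prime] (hE : ∀ e : E, p • e = 0) (T : E →+ E) (e : E) :
    ∑ i ∈ Finset.range p, T^[i] e = (fun e => T e - e)^[p - 1] e :=
  let _ : Module (ZMod p) E := AddCommGroup.zmodModule hE
  LinearMap.sum_iterate_eq_iterate_sub_self (T.toZModLinearMap p) e

/-- If `(α* - 1) ^ (p - 1)` kills `μ`, where `A` has exponent `p`, then so does the norm
`1 + α* + ⋯ + α* ^ (p - 1)`. -/
theorem MonoidHom.prod_iterate_eq_one {R A : Type*} [Group R] [CommGroup A] {p : ℕ}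
    [hp : Fact p.Prime] (hA : ∀ a : A, a ^ p = 1) (α : R →* R) (μ : R →* A)
    (h : (MonoidHom.twistDiff α)^[p - 1] μ = 1) (r : R) :
    ∏ i ∈ Finset.range p, μ (α^[i] r) = 1 := by
  let T : Additive (R →* A) →+ Additive (R →* A) :=
    (MonoidHom.compHom' α : (R →* A) →* (R →* A)).toAdditive
  have hE : ∀ e : Additive (R →* A), p • e = 0 := fun e => MonoidHom.ext fun r => hA _
  have hT : ∀ (i : ℕ) (ν : R →* A) (r : R),
      (T^[i] (Additive.ofMul ν)).toMul r = ν (α^[i] r) := by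
    intro i
    induction i with
    | zero => intro ν r; rfl
    | succ i ih =>
      intro ν r
      rw [Function.iterate_succ_apply, Function.iterate_succ_apply']
      exact ih (ν.comp α) r
  have key : ∑ i ∈ Finset.range p, T^[i] (Additive.ofMul μ) =
      Additive.ofMul ((MonoidHom.twistDiff α)^[p - 1] μ) :=
    AddMonoidHom.sum_iterate_eq_iterate_sub_self hE T (Additive.ofMul μ)
  have key2 := congrArg (fun ν : Additive (R →* A) => ν.toMul r) key
  simp only [h, toMul_sum, toMul_ofMul, MonoidHom.one_apply] at key2
  rw [← key2, MonoidHom.finsetProd_apply]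
  exact Finset.prod_congr rfl fun i _ => (hT i μ r).symm

/-! ### The transfer as a product over all cosets -/

section transfer

variable {G A : Type*} [Group G] [CommGroup A] {N : Subgroup G}

open Classical in
/-- The value of `φ : N →* A` at the conjugate `g⁻¹ u g`, set to `1` when this conjugate is not in
`N`. -/
noncomputable def MonoidHom.conjExtend (φ : N →* A) (u g : G) : A :=
  if h : g⁻¹ * u * g ∈ N then φ ⟨_, h⟩ else 1

theorem MonoidHom.conjExtend_of_mem (φ : N →* A) {u g : G} (h : g⁻¹ * u * g ∈ N) :
    φ.conjExtend u g = φ ⟨_, h⟩ := dif_pos h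

theorem MonoidHom.conjExtend_of_notMem (φ : N →* A) {u g : G} (h : g⁻¹ * u * g ∉ N) :
    φ.conjExtend u g = 1 := dif_neg h

theorem MonoidHom.conjExtend_mul (φ : N →* A) (u g : G) {n : G} (hn : n ∈ N) :
    φ.conjExtend u (g * n) = φ.conjExtend u g := by
  have e : (g * n)⁻¹ * u * (g * n) = n⁻¹ * (g⁻¹ * u * g) * n := by group
  by_cases h : g⁻¹ * u * g ∈ N
  · have h' : (g * n)⁻¹ * u * (g * n) ∈ N := by
      rw [e]; exact mul_mem (mul_mem (inv_mem hn) h) hn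
    rw [φ.conjExtend_of_mem h, φ.conjExtend_of_mem h']
    have : (⟨_, h'⟩ : N) = ⟨n, hn⟩⁻¹ * ⟨_, h⟩ * ⟨n, hn⟩ := Subtype.ext e
    rw [this]
    simp
  · have h' : (g * n)⁻¹ * u * (g * n) ∉ N := by
      rw [e, Subgroup.mul_mem_cancel_right _ hn, Subgroup.mul_mem_cancel_left _ (inv_mem hn)]
      exact h
    rw [φ.conjExtend_of_notMem h, φ.conjExtend_of_notMem h']

/-- `MonoidHom.conjExtend` as a function of the coset `g N`: it does not depend on the
representative because `A` is commutative (`MonoidHom.conjExtend_mul`). -/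
noncomputable def MonoidHom.conjExtendQuot (φ : N →* A) (u : G) (q : G ⧸ N) : A :=
  φ.conjExtend u q.out

theorem MonoidHom.conjExtendQuot_mk (φ : N →* A) (u g : G) :
    φ.conjExtendQuot u (g : G ⧸ N) = φ.conjExtend u g := by
  obtain ⟨n, hn⟩ := QuotientGroup.mk_out_eq_mul N g
  rw [MonoidHom.conjExtendQuot, hn, φ.conjExtend_mul _ _ n.2]

theorem QuotientGroup.smul_mk_eq_iff {u g : G} :
    u • (g : G ⧸ N) = g ↔ g⁻¹ * u * g ∈ N := by
  rw [eq_comm, MulAction.Quotient.smul_mk, QuotientGroup.eq, smul_eq_mul, mul_assoc]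

/-- The transfer of `u` is a product over the cycles of `u` on `G ⧸ N`. If `φ` vanishes on the
conjugates in `N` of all powers `u ^ k` with `k ≠ 1` a divisor of the order of `u`, then only the
fixed cosets `g N` contribute, and such a coset contributes `φ (g⁻¹ u g)`. -/
theorem MonoidHom.transfer_eq_prod_conjExtendQuot [Finite G] [Fintype (G ⧸ N)] (φ : N →* A) (u : G)
    (hu : ∀ (k : ℕ) (g : G) (h : g⁻¹ * u ^ k * g ∈ N), k ∣ orderOf u → k ≠ 1 → φ ⟨_, h⟩ = 1) :
    MonoidHom.transfer φ u = ∏ q : G ⧸ N, φ.conjExtendQuot u q := by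
  classical
  have : Fintype (Quotient (MulAction.orbitRel (Subgroup.zpowers u) (G ⧸ N))) := Fintype.ofFinite _
  have hfix : ∀ q : G ⧸ N, u • q ≠ q → φ.conjExtendQuot u q = 1 := by
    intro q hq
    refine φ.conjExtend_of_notMem fun h => hq ?_
    rw [← QuotientGroup.smul_mk_eq_iff] at h
    simpa using h
  have hz : ∀ q : G ⧸ N, u • q = q → ∀ q',
      MulAction.orbitRel (Subgroup.zpowers u) (G ⧸ N) q' q → q' = q := by
    rintro q hq q' ⟨⟨_, k, rfl⟩, rfl⟩
    change u ^ k • q = q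
    have : u ∈ MulAction.stabilizer G q := hq
    exact zpow_mem this k
  rw [φ.transfer_eq_prod_quotient_orbitRel_zpowers_quot]
  symm
  refine Finset.prod_bij_ne_one (fun q _ _ => Quotient.mk'' q) (fun _ _ _ => Finset.mem_univ _)
    ?_ ?_ ?_
  · intro q _ h q' _ h' e
    have hq' : u • q' = q' := by by_contra hh; exact h' (hfix _ hh)
    exact hz q' hq' q (Quotient.exact e)
  · intro ω _ hω
    have h1 : u • ω.out = ω.out := by
      by_contra hne
      refine hω (hu _ _ _ ?_ ?_)
      · apply Function.IsPeriodicPt.minimalPeriod_dvd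
        change (u • ·)^[orderOf u] ω.out = ω.out
        rw [smul_iterate, pow_orderOf_eq_one]
        exact one_smul _ _
      · intro h
        exact hne (Function.minimalPeriod_eq_one_iff_isFixedPt.1 h)
    refine ⟨ω.out, Finset.mem_univ _, ?_, Quotient.out_eq' ω⟩
    intro h2
    apply hω
    rw [MonoidHom.conjExtendQuot, φ.conjExtend_of_mem
      (QuotientGroup.smul_mk_eq_iff.1 (by simpa using h1))] at h2
    rw [← h2]
    congr 2
    rw [Function.minimalPeriod_eq_one_iff_isFixedPt.2 h1, pow_one]
  · intro q _ h
    have hq : u • q = q := by by_contra hh; exact h (hfix _ hh)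
    have e : (Quotient.mk'' q :
        Quotient (MulAction.orbitRel (Subgroup.zpowers u) (G ⧸ N))).out = q :=
      hz q hq _ (Quotient.exact (Quotient.out_eq' _))
    rw [MonoidHom.conjExtendQuot, φ.conjExtend_of_mem
      (QuotientGroup.smul_mk_eq_iff.1 (by simpa using hq))]
    congr 2
    rw [e, Function.minimalPeriod_eq_one_iff_isFixedPt.2 hq, pow_one]

end transfer

/-! ### Products over orbits of a subgroup on cosets -/

section orbit

variable {G A : Type*} [Group G] [CommGroup A] {N : Subgroup G}

/-- Conjugation `r ↦ x⁻¹ r x` on `R` by an element `x` of the normalizer of `R`. -/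
def Subgroup.conjOfMemNormalizer {Γ : Type*} [Group Γ] (R : Subgroup Γ) {x : Γ}
    (hx : x ∈ Subgroup.normalizer (R : Set Γ)) : R →* R where
  toFun r := ⟨x⁻¹ * r * x, (Subgroup.mem_normalizer_iff''.1 hx _).1 r.2⟩
  map_one' := by ext; simp
  map_mul' a b := by ext; simp [mul_assoc]

theorem Subgroup.coe_conjOfMemNormalizer_iterate {Γ : Type*} [Group Γ] (R : Subgroup Γ) {x : Γ}
    (hx : x ∈ Subgroup.normalizer (R : Set Γ)) (i : ℕ) (r : R) :
    (((R.conjOfMemNormalizer hx)^[i] r : R) : Γ) = (x ^ i)⁻¹ * r * x ^ i := by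
  induction i with
  | zero => simp
  | succ i ih =>
    rw [Function.iterate_succ_apply']
    change x⁻¹ * _ * x = _
    rw [ih]
    simp [pow_succ, mul_assoc]

theorem Subgroup.inv_mul_mul_mem_of_mem_stabilizer {H : Subgroup G} {g : G}
    (r : MulAction.stabilizer H (g : G ⧸ N)) : g⁻¹ * ((r : H) : G) * g ∈ N :=
  QuotientGroup.smul_mk_eq_iff.1 r.2

/-- The homomorphism `r ↦ φ (g⁻¹ r g)` on the stabilizer in `H` of the coset `g N`. -/
def MonoidHom.conjStabilizer (φ : N →* A) (H : Subgroup G) (g : G) :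
    MulAction.stabilizer H (g : G ⧸ N) →* A where
  toFun r := φ ⟨g⁻¹ * ((r : H) : G) * g, Subgroup.inv_mul_mul_mem_of_mem_stabilizer r⟩
  map_one' := by rw [← map_one φ]; congr 2; simp
  map_mul' a b := by rw [← map_mul]; congr 2; simp [mul_assoc]

/-- The product of `MonoidHom.conjExtendQuot` over the `H`-orbit of `g N` is trivial if the
homomorphism `r ↦ φ (g⁻¹ r g)` on the stabilizer `R` of `g N` has trivial norm for the conjugation
by some `x` which normalizes `R` and has order `p` modulo `R`. -/
theorem MonoidHom.prod_conjExtendQuot_orbit {p : ℕ} [Fact p.Prime] (φ : N →* A) (H : Subgroup G)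
    (u : H) (g : G) [Fintype (H ⧸ MulAction.stabilizer H (g : G ⧸ N))] {x : H}
    (hx : x ∈ Subgroup.normalizer (MulAction.stabilizer H (g : G ⧸ N) : Set H))
    (hxR : x ∉ MulAction.stabilizer H (g : G ⧸ N))
    (hxp : x ^ p ∈ MulAction.stabilizer H (g : G ⧸ N))
    (h : ∀ r : MulAction.stabilizer H (g : G ⧸ N), ∏ i ∈ Finset.range p,
      φ.conjStabilizer H g ((Subgroup.conjOfMemNormalizer _ hx)^[i] r) = 1) :
    ∏ y : H ⧸ MulAction.stabilizer H (g : G ⧸ N),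
      φ.conjExtendQuot (u : G) (MulAction.ofQuotientStabilizer H (g : G ⧸ N) y) = 1 := by
  refine Subgroup.prod_quotient_eq_one_of_mem_normalizer (p := p) _ hx hxR hxp _ fun s => ?_
  have hF : ∀ i : ℕ, φ.conjExtendQuot (u : G) (MulAction.ofQuotientStabilizer H (g : G ⧸ N)
      ((s * x ^ i : H) : H ⧸ MulAction.stabilizer H (g : G ⧸ N))) =
        φ.conjExtend u ((s : G) * (x : G) ^ i * g) := by
    intro i
    rw [← MonoidHom.conjExtendQuot_mk]
    rfl
  simp only [hF]
  have hmem : ∀ (i : ℕ) (r : H), ((s : G) * (x : G) ^ i * g)⁻¹ * r * ((s : G) * (x : G) ^ i * g) =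
      g⁻¹ * (((x ^ i)⁻¹ * (s⁻¹ * r * s) * x ^ i : H) : G) * g := by
    intro i r
    simp [mul_assoc]
  by_cases hu : s⁻¹ * u * s ∈ MulAction.stabilizer H (g : G ⧸ N)
  · rw [← h ⟨_, hu⟩]
    refine Finset.prod_congr rfl fun i _ => ?_
    have e : ((s : G) * (x : G) ^ i * g)⁻¹ * u * ((s : G) * (x : G) ^ i * g) =
      g⁻¹ * ((((Subgroup.conjOfMemNormalizer _ hx)^[i] ⟨_, hu⟩ :
        MulAction.stabilizer H (g : G ⧸ N)) : H) : G) * g := by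
      rw [Subgroup.coe_conjOfMemNormalizer_iterate, hmem]
    rw [φ.conjExtend_of_mem (by rw [e]; exact Subgroup.inv_mul_mul_mem_of_mem_stabilizer _)]
    change _ = φ _
    congr 2
  · refine Finset.prod_eq_one fun i _ => φ.conjExtend_of_notMem fun hc => hu ?_
    rw [hmem] at hc
    have : (x ^ i)⁻¹ * (s⁻¹ * u * s) * x ^ i ∈ MulAction.stabilizer H (g : G ⧸ N) :=
      QuotientGroup.smul_mk_eq_iff.2 hc
    exact (Subgroup.mem_normalizer_iff''.1 (pow_mem hx i) _).2 this

end orbit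

/-! ### Subgroups of a `p`-group not properly containing a term of the upper central series -/

section central

open scoped commutatorElement

variable {Γ : Type*} [Group Γ]

theorem IsPGroup.exists_mem_notMem_pow_mem {p : ℕ} (hΓ : IsPGroup p Γ) {K R : Subgroup Γ}
    (h : ¬ K ≤ R) : ∃ x ∈ K, x ∉ R ∧ x ^ p ∈ R := by
  classical
  obtain ⟨y, hyK, hyR⟩ := SetLike.not_le_iff_exists.1 h
  have hex : ∃ k, y ^ p ^ k ∈ R := by
    obtain ⟨k, hk⟩ := (isPGroup_iff_pow_pow_eq_one.1 hΓ) y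
    exact ⟨k, by rw [hk]; exact one_mem R⟩
  obtain ⟨k, hk⟩ : ∃ k, Nat.find hex = k + 1 := by
    refine Nat.exists_eq_succ_of_ne_zero fun h0 => hyR ?_
    simpa [h0] using Nat.find_spec hex
  refine ⟨y ^ p ^ k, pow_mem hyK _, Nat.find_min hex (by omega), ?_⟩
  rw [← pow_mul, ← pow_succ, ← hk]
  exact Nat.find_spec hex

theorem Subgroup.upperCentralSeries_le_normalizer (R : Subgroup Γ) (i : ℕ)
    (h : upperCentralSeries Γ i ≤ R) :
    upperCentralSeries Γ (i + 1) ≤ Subgroup.normalizer (R : Set Γ) := by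
  have key : ∀ x ∈ upperCentralSeries Γ (i + 1), ∀ r ∈ R, x * r * x⁻¹ ∈ R := by
    intro x hx r hr
    have := mul_mem (h (mem_upperCentralSeries_succ_iff.1 hx r)) hr
    simpa [commutatorElement_def, mul_assoc] using this
  intro x hx
  rw [mem_normalizer_iff]
  refine fun r => ⟨key x hx r, fun hr => ?_⟩
  simpa [mul_assoc] using key x⁻¹ (inv_mem hx) _ hr

variable {A : Type*} [CommGroup A]

/-- Conjugation by `x` moves elements of the `j + 1`-st term of the upper central series only by
elements of the `j`-th term, so `j` differences kill the values at the `j`-th term. -/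
theorem Subgroup.iterate_twistDiff_apply_eq_one (R : Subgroup Γ) {x : Γ}
    (hx : x ∈ normalizer (R : Set Γ)) (μ : R →* A) (j : ℕ) (r : R)
    (hr : (r : Γ) ∈ upperCentralSeries Γ j) :
    (MonoidHom.twistDiff (R.conjOfMemNormalizer hx))^[j] μ r = 1 := by
  induction j generalizing r with
  | zero =>
    have : r = 1 := by ext; simpa using hr
    rw [this, map_one]
  | succ j ih =>
    rw [Function.iterate_succ_apply', MonoidHom.twistDiff_apply]
    apply ih
    have := inv_mem (mem_upperCentralSeries_succ_iff.1 hr x⁻¹)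
    have e : x⁻¹ * (r : Γ) * x * (r : Γ)⁻¹ = ⁅(r : Γ), x⁻¹⁆⁻¹ := by
      simp [commutatorElement_def, mul_assoc]
    change x⁻¹ * (r : Γ) * x * (r : Γ)⁻¹ ∈ _
    rwa [e]

/-- If `x` lies in the `j + 1`-st term of the upper central series, then conjugation by `x` moves
every element of `R` by an element of the `j`-th term. -/
theorem Subgroup.iterate_twistDiff_eq_one_of_mem (R : Subgroup Γ) {x : Γ}
    (hx : x ∈ normalizer (R : Set Γ)) (μ : R →* A) (j : ℕ)
    (hxj : x ∈ upperCentralSeries Γ (j + 1)) :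
    (MonoidHom.twistDiff (R.conjOfMemNormalizer hx))^[j + 1] μ = 1 := by
  ext r
  rw [Function.iterate_succ_apply', MonoidHom.twistDiff_apply]
  apply R.iterate_twistDiff_apply_eq_one
  have := mem_upperCentralSeries_succ_iff.1 (inv_mem hxj) r
  have e : x⁻¹ * (r : Γ) * x * (r : Γ)⁻¹ = ⁅x⁻¹, (r : Γ)⁆ := by
    simp [commutatorElement_def, mul_assoc]
  change x⁻¹ * (r : Γ) * x * (r : Γ)⁻¹ ∈ _
  rwa [e]

theorem MonoidHom.iterate_twistDiff_eq_one_of_le {R : Type*} [Group R] (α : R →* R) (μ : R →* A)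
    {i j : ℕ} (hij : i ≤ j) (h : (MonoidHom.twistDiff α)^[i] μ = 1) :
    (MonoidHom.twistDiff α)^[j] μ = 1 := by
  obtain ⟨k, rfl⟩ := Nat.exists_eq_add_of_le' hij
  rw [Function.iterate_add_apply, h]
  refine Function.iterate_fixed ?_ k
  ext r
  simp [MonoidHom.twistDiff]

/-- A proper subgroup `R` of a finite `p`-group which does not properly contain the `n`-th term
`Z n` of the upper central series is normalized by some `x` of order `p` modulo `R` such that `n`
differences along conjugation by `x` kill every homomorphism from `R` to an abelian group. -/
theorem IsPGroup.exists_normalizer_iterate_twistDiff_eq_one [Finite Γ] {p : ℕ} [Fact p.Prime]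
    (hΓ : IsPGroup p Γ) {n : ℕ} {R : Subgroup Γ} (hR : R ≠ ⊤)
    (hZ : ¬ Subgroup.upperCentralSeries Γ n < R) :
    ∃ x, ∃ hx : x ∈ Subgroup.normalizer (R : Set Γ), x ∉ R ∧ x ^ p ∈ R ∧
      ∀ μ : R →* A, (MonoidHom.twistDiff (R.conjOfMemNormalizer hx))^[n] μ = 1 := by
  classical
  by_cases hle : Subgroup.upperCentralSeries Γ n ≤ R
  · obtain rfl : Subgroup.upperCentralSeries Γ n = R := by
      by_contra hne
      exact hZ (lt_of_le_of_ne hle hne)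
    -- here `R = Z n` is normal, and any `x` of order `p` modulo `R` will do
    obtain ⟨x, -, hxR, hxp⟩ := hΓ.exists_mem_notMem_pow_mem
      (K := ⊤) (R := Subgroup.upperCentralSeries Γ n) (by rwa [top_le_iff])
    refine ⟨x, Subgroup.normalizer_eq_top (Subgroup.upperCentralSeries Γ n) ▸ Subgroup.mem_top x,
      hxR, hxp, fun μ => ?_⟩
    ext r
    exact Subgroup.iterate_twistDiff_apply_eq_one _ _ _ _ _ r.2
  · -- `x` is taken in the first term of the series that is not contained in `R`
    have hex : ∃ i, ¬ Subgroup.upperCentralSeries Γ i ≤ R := ⟨n, hle⟩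
    obtain ⟨i, hi⟩ : ∃ i, Nat.find hex = i + 1 := by
      refine Nat.exists_eq_succ_of_ne_zero fun h0 => ?_
      have := Nat.find_spec hex
      rw [h0, Subgroup.upperCentralSeries_zero] at this
      exact this bot_le
    have hspec := Nat.find_spec hex
    have hmin : Subgroup.upperCentralSeries Γ i ≤ R :=
      not_not.1 (Nat.find_min hex (m := i) (by omega))
    have hin : i + 1 ≤ n := hi ▸ Nat.find_min' hex hle
    rw [hi] at hspec
    obtain ⟨x, hxZ, hxR, hxp⟩ := hΓ.exists_mem_notMem_pow_mem hspec
    exact ⟨x, R.upperCentralSeries_le_normalizer i hmin hxZ, hxR, hxp, fun μ =>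
      MonoidHom.iterate_twistDiff_eq_one_of_le _ _ hin
        (R.iterate_twistDiff_eq_one_of_mem _ μ i hxZ)⟩

end central

/-! ### Sylow subgroups meeting in a large intersection -/

section fusion

variable {G : Type*} [Group G]

/-- Normalizers grow in a finite `p`-group, stated inside an ambient group. -/
theorem IsPGroup.lt_inf_normalizer [Finite G] {p : ℕ} [Fact p.Prime] {P R : Subgroup G}
    (hP : IsPGroup p P) (h : R < P) : R < P ⊓ Subgroup.normalizer (R : Set G) := by
  have := hP.isNilpotent
  have hlt : R.subgroupOf P < ⊤ := by
    rw [lt_top_iff_ne_top, ne_eq, Subgroup.subgroupOf_eq_top]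
    exact not_le_of_gt h
  obtain ⟨y, hyN, hyR⟩ := SetLike.exists_of_lt
    (Group.normalizerCondition_of_isNilpotent (G := P) _ hlt)
  rw [SetLike.lt_iff_le_and_exists]
  refine ⟨le_inf h.le Subgroup.le_normalizer, y, ⟨y.2, ?_⟩, fun hy => hyR ?_⟩
  · change (y : G) ∈ Subgroup.normalizer (R : Set G)
    rw [Subgroup.mem_normalizer_iff]
    intro r
    rw [Subgroup.mem_normalizer_iff] at hyN
    constructor
    · intro hr
      exact (hyN ⟨r, h.le hr⟩).1 hr
    · intro hr
      have hrP : r ∈ P := by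
        have := mul_mem (mul_mem (inv_mem y.2) (h.le hr)) y.2
        simpa [mul_assoc] using this
      exact (hyN ⟨r, hrP⟩).2 hr
  · exact hy

theorem Sylow.mem_smul_iff {p : ℕ} {P : Sylow p G} {g x : G} : x ∈ g • P ↔ g⁻¹ * x * g ∈ P := by
  change x ∈ ((g • P : Sylow p G) : Subgroup G) ↔ g⁻¹ * x * g ∈ (P : Subgroup G)
  rw [Sylow.smul_def, Sylow.pointwise_smul_def, Subgroup.mem_pointwise_smul_iff_inv_smul_mem]
  simp [MulAut.smul_def, ← map_inv]

theorem Sylow.eq_of_le {p : ℕ} {P Q : Sylow p G} (h : (P : Subgroup G) ≤ Q) : P = Q :=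
  Sylow.ext (P.is_maximal' Q.isPGroup' h).symm

variable [Finite G] {p : ℕ} [Fact p.Prime]

/-- Suppose that `N_G(P ∩ Q)` is `p`-nilpotent for every tame intersection `P ∩ Q < P` properly
containing `Z`. Then *every* Sylow subgroup `Q` such that `Z < P ∩ Q` is conjugate to `P` by an
element centralizing `P ∩ Q`. The proof is by downward induction on `R = P ∩ Q`, as for Alperin's
fusion theorem: the induction hypothesis, applied to Sylow subgroups which meet `P` in more than
`R`, shows that `P` and `Q` are conjugate under `N_G(R)` and that `P ∩ Q` is tame. As `N_G(R)` is
the product of `N_P(R)` and a normal `p'`-subgroup, and the latter centralizes `R`, the conjugating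
element may be taken in the centralizer. -/
theorem Sylow.exists_centralizer_smul_eq (P : Sylow p G) (Z : Subgroup G)
    (h : ∀ Q : Sylow p G, PTransfer.IsTameIntersection P Q → Z < (P ⊓ Q : Subgroup G) →
      (P ⊓ Q : Subgroup G) < P →
      PTransfer.IsPNilpotent p (Subgroup.normalizer ((P ⊓ Q : Subgroup G) : Set G)))
    (R : Subgroup G) (Q : Sylow p G) (hPQ : (P ⊓ Q : Subgroup G) = R) (hZ : Z < R) :
    ∃ c ∈ Subgroup.centralizer (R : Set G), c • P = Q := by
  induction R using WellFoundedGT.induction generalizing Q with | ind R ih => ?_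
  have hRP : R ≤ P := hPQ ▸ inf_le_left
  have hRQ : R ≤ Q := hPQ ▸ inf_le_right
  by_cases hR : R = P
  · exact ⟨1, one_mem _, by rw [one_smul]; exact Sylow.eq_of_le (hR ▸ hRQ)⟩
  have hRP' : R < P := lt_of_le_of_ne hRP hR
  have hRQ' : R < Q := by
    refine lt_of_le_of_ne hRQ fun he => hR ?_
    rw [Sylow.eq_of_le (he ▸ hRP : (Q : Subgroup G) ≤ P)] at he
    exact he
  set K : Subgroup G := Subgroup.normalizer (R : Set G) with hK
  have hRK : R ≤ K := Subgroup.le_normalizer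
  have hcK : Subgroup.centralizer (R : Set G) ≤ K := by
    intro c hc
    rw [Subgroup.mem_centralizer_iff] at hc
    rw [hK, Subgroup.mem_normalizer_iff]
    have : ∀ r ∈ R, c⁻¹ * r * c = r := fun r hr => by
      rw [mul_assoc, hc r hr, inv_mul_cancel_left]
    refine fun r => ⟨fun hr => ?_, fun hr => ?_⟩
    · rw [← hc r hr, mul_inv_cancel_right]; exact hr
    · have := this _ hr
      rw [show c⁻¹ * (c * r * c⁻¹) * c = r by group] at this
      rwa [this]
  -- `N_P(R)` is a Sylow subgroup of `N_G(R)`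
  obtain ⟨TP, hTP⟩ : ∃ T : Sylow p K, (T : Subgroup K) = ((P : Subgroup G) ⊓ K).subgroupOf K := by
    have hp : IsPGroup p (((P : Subgroup G) ⊓ K).subgroupOf K) :=
      (P.isPGroup'.to_le inf_le_left).comap_subtype
    obtain ⟨T, hT⟩ := hp.exists_le_sylow
    obtain ⟨S, hS⟩ := (T.isPGroup'.map K.subtype).exists_le_sylow
    have hle : (P : Subgroup G) ⊓ K ≤ S := by
      intro x hx
      exact hS ⟨⟨x, hx.2⟩, hT hx, rfl⟩
    have hlt : R < (P ⊓ S : Subgroup G) :=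
      lt_of_lt_of_le (P.isPGroup'.lt_inf_normalizer hRP') (le_inf inf_le_left hle)
    obtain ⟨c, hc, rfl⟩ := ih _ hlt S rfl (hZ.trans hlt)
    have hcK' : c ∈ K := hcK (Subgroup.centralizer_le (SetLike.coe_subset_coe.2 hlt.le) hc)
    have hconj : ∀ t : T, c⁻¹ * ((t : K) : G) * c ∈ (P : Subgroup G) := fun t =>
      Sylow.mem_smul_iff.1 (hS ⟨t, t.2, rfl⟩)
    refine ⟨T, (Subgroup.eq_of_le_of_card_ge hT ?_).symm⟩
    have hmem : ∀ t : T, c⁻¹ * ((t : K) : G) * c ∈ K := fun t =>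
      mul_mem (mul_mem (inv_mem hcK') t.1.2) hcK'
    refine Nat.card_le_card_of_injective
      (fun t : T => (⟨⟨_, hmem t⟩, hconj t, hmem t⟩ : ((P : Subgroup G) ⊓ K).subgroupOf K)) ?_
    intro a b hab
    have hab' : c⁻¹ * ((a : K) : G) * c = c⁻¹ * ((b : K) : G) * c :=
      congrArg (fun t : ((P : Subgroup G) ⊓ K).subgroupOf K => ((t : K) : G)) hab
    exact Subtype.ext (Subtype.ext (mul_left_cancel (mul_right_cancel hab')))
  have memTP : ∀ k : K, k ∈ TP ↔ (k : G) ∈ P := by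
    intro k
    change k ∈ (TP : Subgroup K) ↔ _
    rw [hTP]
    exact ⟨fun hk => hk.1, fun hk => ⟨hk, k.2⟩⟩
  -- `P` and `Q` are conjugate under `N_G(R)`
  obtain ⟨y, hyK, rfl⟩ : ∃ y ∈ K, y • P = Q := by
    have hp : IsPGroup p (((Q : Subgroup G) ⊓ K).subgroupOf K) :=
      (Q.isPGroup'.to_le inf_le_left).comap_subtype
    obtain ⟨T, hT⟩ := hp.exists_le_sylow
    obtain ⟨g, rfl⟩ := MulAction.exists_smul_eq K TP T
    have hconj : ∀ x ∈ (Q : Subgroup G) ⊓ K, (g : G)⁻¹ * x * g ∈ P := by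
      intro x hx
      exact (memTP _).1 (Sylow.mem_smul_iff.1 (hT (show (⟨x, hx.2⟩ : K) ∈ _ from hx)))
    have hlt : R < (P ⊓ ((g : G)⁻¹ • Q : Sylow p G) : Subgroup G) := by
      obtain ⟨-, x, hxQ, hxR⟩ := SetLike.lt_iff_le_and_exists.1
        (Q.isPGroup'.lt_inf_normalizer hRQ')
      rw [SetLike.lt_iff_le_and_exists]
      refine ⟨le_inf hRP fun r hr => Sylow.mem_smul_iff.2 ?_, (g : G)⁻¹ * x * g,
        ⟨hconj x hxQ, Sylow.mem_smul_iff.2 ?_⟩, ?_⟩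
      · rw [inv_inv]
        exact hRQ ((Subgroup.mem_normalizer_iff.1 g.2 r).1 hr)
      · simpa [mul_assoc] using hxQ.1
      · exact fun hh => hxR ((Subgroup.mem_normalizer_iff''.1 g.2 x).2 hh)
    obtain ⟨c, hc, hcQ⟩ := ih _ hlt _ rfl (hZ.trans hlt)
    refine ⟨g * c, mul_mem g.2 (hcK (Subgroup.centralizer_le (SetLike.coe_subset_coe.2 hlt.le) hc)),
      ?_⟩
    rw [mul_smul, hcQ, smul_inv_smul]
  have htame : PTransfer.IsTameIntersection P (y • P) := by
    rw [PTransfer.IsTameIntersection, hPQ]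
    refine ⟨⟨inf_le_right, TP, hTP⟩, inf_le_right, (⟨y, hyK⟩ : K) • TP, ?_⟩
    ext k
    change k ∈ (⟨y, hyK⟩ : K) • TP ↔ (k : G) ∈ (y • P : Sylow p G) ∧ (k : G) ∈ K
    rw [Sylow.mem_smul_iff, memTP, Sylow.mem_smul_iff]
    exact ⟨fun hk => ⟨hk, k.2⟩, fun hk => hk.1⟩
  have hnil := h (y • P) htame (hPQ ▸ hZ) (hPQ ▸ hRP')
  rw [hPQ] at hnil
  obtain ⟨L, hL, hLp, n, hLn⟩ := hnil
  have hsup : L ⊔ TP = ⊤ := by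
    rw [← Subgroup.index_eq_one]
    have h1 : (L ⊔ TP : Subgroup K).index ∣ p ^ n := hLn ▸ Subgroup.index_dvd_of_le le_sup_left
    have h2 : ¬ p ∣ (L ⊔ TP : Subgroup K).index := fun hd =>
      TP.not_dvd_index (hd.trans (Subgroup.index_dvd_of_le le_sup_right))
    obtain ⟨m, -, hm⟩ := (Nat.dvd_prime_pow Fact.out).1 h1
    rcases m with _ | m
    · simpa using hm
    · exact absurd (hm ▸ dvd_pow_self p m.succ_ne_zero) h2
  -- the conjugating element is `z * t`, with `z` in the normal `p'`-subgroup and `t ∈ N_P(R)`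
  obtain ⟨z, hz, t, ht, hzt⟩ := Subgroup.mem_sup_of_normal_left.1
    (hsup ▸ Subgroup.mem_top (⟨y, hyK⟩ : K))
  refine ⟨z, ?_, ?_⟩
  · rw [Subgroup.mem_centralizer_iff]
    intro r hr
    have hRp : IsPGroup p (R.subgroupOf K) := (P.isPGroup'.to_le hRP).comap_subtype
    have hdisj : Disjoint L (R.subgroupOf K) :=
      IsPGroup.disjoint_of_coprime IsPGroup.card hRp hLp
    have := Subgroup.commute_of_normal_of_disjoint L (R.subgroupOf K) hL
      Subgroup.normal_in_normalizer hdisj z ⟨r, hRK hr⟩ hz hr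
    exact (congrArg Subtype.val this.eq).symm
  · have htP : (t : G) • P = P := by
      rw [Sylow.smul_eq_iff_mem_normalizer]
      exact Subgroup.le_normalizer ((memTP t).1 ht)
    have e : (z : G) * t = y := congrArg Subtype.val hzt
    rw [← e, mul_smul, htP]

end fusion

/-! ### The abelian `p`-residual and control of transfer -/

namespace PTransfer

theorem abelianPResidual_le_ker {p : ℕ} {G B : Type*} [Group G] [Group B] (hB : IsPGroup p B)
    (hc : ∀ a b : B, a * b = b * a) (f : G →* B) : abelianPResidual p G ≤ f.ker := by
  refine sInf_le ⟨inferInstance, ?_, ?_⟩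
  · exact hB.of_injective (QuotientGroup.kerLift f) (QuotientGroup.kerLift_injective f)
  · refine IsMulCommutative.of_comm fun x y => ?_
    apply QuotientGroup.kerLift_injective f
    rw [map_mul, map_mul, hc]

variable {G : Type*} [Group G] [Finite G] {p : ℕ} [Fact p.Prime]

/-- `A^p(G)` itself has an abelian `p`-quotient. -/
theorem hasAbelianPQuotient_abelianPResidual : HasAbelianPQuotient p (abelianPResidual p G) := by
  refine ⟨inferInstance, ?_, ?_⟩
  · rw [isPGroup_iff_pow_pow_eq_one]
    intro x
    induction x using QuotientGroup.induction_on with | H g => ?_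
    -- the exponent `|G|` serves for all quotients at once: an order `p ^ k ≤ |G|` has `k ≤ |G|`
    refine ⟨Nat.card G, ?_⟩
    rw [← QuotientGroup.mk_pow, QuotientGroup.eq_one_iff, abelianPResidual, Subgroup.mem_sInf]
    rintro K ⟨hK, hKp, -⟩
    rw [← QuotientGroup.eq_one_iff (N := K), QuotientGroup.mk_pow]
    obtain ⟨k, hk⟩ := (IsPGroup.iff_orderOf.1 hKp) (g : G ⧸ K)
    rw [← orderOf_dvd_iff_pow_eq_one, hk]
    refine pow_dvd_pow p ?_
    have h1 : p ^ k ≤ Nat.card G := hk ▸ (orderOf_le_card (x := (g : G ⧸ K))).trans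
      (Nat.card_le_card_of_surjective _ (QuotientGroup.mk'_surjective K))
    exact (Nat.lt_pow_self (Fact.out : p.Prime).one_lt).le.trans h1
  · refine IsMulCommutative.of_comm fun x y => ?_
    induction x using QuotientGroup.induction_on with | H a => ?_
    induction y using QuotientGroup.induction_on with | H b => ?_
    rw [← QuotientGroup.mk_mul, ← QuotientGroup.mk_mul, QuotientGroup.eq, abelianPResidual,
      Subgroup.mem_sInf]
    rintro K ⟨hK, -, hKc⟩
    rw [← QuotientGroup.eq, QuotientGroup.mk_mul, QuotientGroup.mk_mul]
    exact mul_comm' _ _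

/-- A surjection `G → N / A^p(N)` factors through `G / A^p(G)`, and inclusion induces a surjection
`N / A^p(N) → G / A^p(G)` because the index of `N` is prime to `p`. Comparing orders, the latter is
an isomorphism. -/
theorem controlsPTransfer_of_surjective {N : Subgroup G} (hN : N.index.Coprime p)
    (v : G →* N ⧸ abelianPResidual p N) (hv : Function.Surjective v) : ControlsPTransfer p N := by
  refine ⟨hN, ?_⟩
  obtain ⟨_, hBp, _⟩ := hasAbelianPQuotient_abelianPResidual (p := p) (G := N)
  obtain ⟨_, hCp, _⟩ := hasAbelianPQuotient_abelianPResidual (p := p) (G := G)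
  let f : N →* G ⧸ abelianPResidual p G := (QuotientGroup.mk' _).comp N.subtype
  have hf : Function.Surjective f := by
    rw [← MonoidHom.range_eq_top, ← Subgroup.index_eq_one]
    obtain ⟨n, hn⟩ := hCp.index f.range
    have h1 : f.range.index ∣ N.index := by
      have : f.range = N.map (QuotientGroup.mk' (abelianPResidual p G)) := by
        rw [MonoidHom.range_comp, Subgroup.range_subtype]
      rw [this]
      exact Subgroup.index_map_dvd _ (QuotientGroup.mk'_surjective _)
    have h2 : (p ^ n).Coprime p := hn ▸ hN.coprime_dvd_left h1
    rcases n with _ | n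
    · simpa using hn
    · have := Nat.Coprime.eq_one_of_dvd h2.symm (dvd_pow_self p n.succ_ne_zero)
      exact absurd this (Fact.out : p.Prime).one_lt.ne'
  let f' : (N ⧸ abelianPResidual p N) →* (G ⧸ abelianPResidual p G) :=
    QuotientGroup.lift _ f (abelianPResidual_le_ker hCp mul_comm' f)
  let v' : (G ⧸ abelianPResidual p G) →* (N ⧸ abelianPResidual p N) :=
    QuotientGroup.lift _ v (abelianPResidual_le_ker hBp mul_comm' v)
  have hf' : Function.Surjective f' := QuotientGroup.lift_surjective_of_surjective _ _ hf _
  have hv' : Function.Surjective v' := QuotientGroup.lift_surjective_of_surjective _ _ hv _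
  have hcard := le_antisymm (Nat.card_le_card_of_surjective _ hf')
    (Nat.card_le_card_of_surjective _ hv')
  exact ⟨MulEquiv.ofBijective f'
    ((Nat.bijective_iff_surjective_and_card f').2 ⟨hf', hcard.symm⟩)⟩

end PTransfer

/-- A proper subgroup of a finite abelian `p`-group is contained in a proper subgroup whose
quotient has exponent dividing `p`. -/
theorem IsPGroup.exists_le_ne_top_forall_pow_eq_one {B : Type*} [CommGroup B] [Finite B] {p : ℕ}
    [Fact p.Prime] (hB : IsPGroup p B) {H : Subgroup B} (hH : H ≠ ⊤) :
    ∃ K : Subgroup B, H ≤ K ∧ K ≠ ⊤ ∧ ∀ a : B ⧸ K, a ^ p = 1 := by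
  -- if `H B ^ p = B`, then `p`-th powers are a surjective, hence injective, map on `B ⧸ H`
  let K : Subgroup B := H ⊔ (powMonoidHom p : B →* B).range
  refine ⟨K, le_sup_left, fun hK => hH ?_, fun a => ?_⟩
  · have hs : Function.Surjective (powMonoidHom p : B ⧸ H →* B ⧸ H) := by
      intro b
      induction b using QuotientGroup.induction_on with | H b => ?_
      obtain ⟨h, hh, _, ⟨c, rfl⟩, rfl⟩ := Subgroup.mem_sup.1 (hK ▸ Subgroup.mem_top b : b ∈ K)
      refine ⟨(c : B ⧸ H), ?_⟩
      rw [QuotientGroup.mk_mul, (QuotientGroup.eq_one_iff h).2 hh, one_mul]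
      rfl
    have hi := Finite.injective_iff_surjective.2 hs
    have hq : IsPGroup p (B ⧸ H) := hB.to_quotient H
    rw [← QuotientGroup.subsingleton_iff]
    by_contra hn
    rw [not_subsingleton_iff_nontrivial] at hn
    obtain ⟨n, hn0, hn⟩ := hq.nontrivial_iff_card.1 hn
    obtain ⟨x, hx⟩ := exists_prime_orderOf_dvd_card' (G := B ⧸ H) p
      (hn ▸ dvd_pow_self p hn0.ne')
    have : x = 1 := hi (by simp [← hx, pow_orderOf_eq_one])
    rw [this, orderOf_one] at hx
    exact (Fact.out : p.Prime).one_lt.ne hx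
  · induction a using QuotientGroup.induction_on with | H b => ?_
    rw [← QuotientGroup.mk_pow, QuotientGroup.eq_one_iff]
    exact Subgroup.mem_sup_right ⟨b, rfl⟩

/-! ### Transfer into an elementary abelian quotient of the Sylow normalizer -/

theorem MonoidHom.transfer_comp {G A B : Type*} [Group G] [CommGroup A] [CommGroup B]
    {N : Subgroup G} [N.FiniteIndex] (f : A →* B) (φ : N →* A) (g : G) :
    MonoidHom.transfer (f.comp φ) g = f (MonoidHom.transfer φ g) := by
  let T : N.LeftTransversal := default
  rw [MonoidHom.transfer_def _ T, MonoidHom.transfer_def _ T, Subgroup.leftTransversals.diff,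
    Subgroup.leftTransversals.diff, map_prod]
  rfl

theorem Sylow.mem_of_mem_normalizer_of_pow_eq_one {G : Type*} [Group G] {p : ℕ} (P : Sylow p G)
    {g : G} (hg : g ∈ Subgroup.normalizer ((P : Subgroup G) : Set G)) {k : ℕ} (hk : g ^ p ^ k = 1) :
    g ∈ P := by
  have hz : IsPGroup p (Subgroup.zpowers g) := by
    refine IsPGroup.of_card_dvd_pow (n := k) ?_
    rw [Nat.card_zpowers]
    exact orderOf_dvd_of_pow_eq_one hk
  have := hz.inf_normalizer_sylow P
  exact (this ▸ (⟨Subgroup.mem_zpowers g, hg⟩ :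
    g ∈ Subgroup.zpowers g ⊓ Subgroup.normalizer ((P : Subgroup G) : Set G)) :
    g ∈ Subgroup.zpowers g ⊓ (P : Subgroup G)).2

section sylow

variable {G A : Type*} [Group G] [Finite G] [CommGroup A] {p : ℕ} [Fact p.Prime]

/-- A nontrivial homomorphism from the normalizer `N` of `P` to a group of exponent `p` is
nontrivial on `P`, since `P` has index prime to `p` in `N`. -/
theorem Sylow.exists_apply_ne_one (P : Sylow p G) {N : Subgroup G}
    (hN : N = Subgroup.normalizer ((P : Subgroup G) : Set G)) (hA : ∀ a : A, a ^ p = 1)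
    {φ : N →* A} (hφ : φ ≠ 1) :
    ∃ u : N, (u : G) ∈ P ∧ φ u ≠ 1 := by
  have hPN : (P : Subgroup G) ≤ N := hN ▸ Subgroup.le_normalizer
  by_contra! hc
  refine hφ (MonoidHom.ext fun n => ?_)
  let P' : Sylow p N := P.subtype hPN
  have : (P' : Subgroup N).Normal := by
    subst hN
    exact Subgroup.normal_in_normalizer
  have h1 : φ n ^ (P' : Subgroup N).index = 1 := by
    rw [← map_pow]
    exact hc (n ^ (P' : Subgroup N).index) ((P' : Subgroup N).pow_index_mem n)
  have h2 : (P' : Subgroup N).index.Coprime p :=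
    ((Nat.Prime.coprime_iff_not_dvd Fact.out).2 P'.not_dvd_index).symm
  have h3 := Nat.dvd_gcd (orderOf_dvd_of_pow_eq_one h1) (orderOf_dvd_of_pow_eq_one (hA (φ n)))
  rw [h2.gcd_eq_one, Nat.dvd_one, orderOf_eq_one_iff] at h3
  exact h3

/-- The `P`-orbit of a coset `g N` other than `N` contributes trivially to the transfer. The
stabilizer `R` of `g N` in `P` is `P ∩ g P g⁻¹`. If `R` does not properly contain `Z_{p-1}(P)`, then
the norm of any homomorphism `R → A` along a suitable `x` vanishes. Otherwise `g` may be replaced by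
an element of the centralizer of `R`, so `r ↦ φ (g⁻¹ r g)` is the restriction of `φ`; it is
invariant under conjugation by `P`, and its norm is its `p`-th power. -/
theorem Sylow.prod_conjExtendQuot_orbit_eq_one (P : Sylow p G) {N : Subgroup G}
    (hN : N = Subgroup.normalizer ((P : Subgroup G) : Set G)) (hA : ∀ a : A, a ^ p = 1)
    (h : ∀ Q : Sylow p G, PTransfer.IsTameIntersection P Q →
      (Subgroup.upperCentralSeries P (p - 1)).map (P : Subgroup G).subtype < (P ⊓ Q : Subgroup G) →
      (P ⊓ Q : Subgroup G) < P →
      PTransfer.IsPNilpotent p (Subgroup.normalizer ((P ⊓ Q : Subgroup G) : Set G)))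
    (φ : N →* A) (u : (P : Subgroup G)) {g : G}
    (hg : g ∉ N)
    [Fintype ((P : Subgroup G) ⧸ MulAction.stabilizer (P : Subgroup G)
      (g : G ⧸ N))] :
    ∏ y : (P : Subgroup G) ⧸ MulAction.stabilizer (P : Subgroup G)
        (g : G ⧸ N),
      φ.conjExtendQuot (u : G) (MulAction.ofQuotientStabilizer (P : Subgroup G)
        (g : G ⧸ N) y) = 1 := by
  have hPN : (P : Subgroup G) ≤ N := hN ▸ Subgroup.le_normalizer
  have hmem : ∀ r : (P : Subgroup G), r ∈ MulAction.stabilizer (P : Subgroup G) (g : G ⧸ N) ↔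
      (r : G) ∈ g • P := by
    intro r
    rw [Sylow.mem_smul_iff]
    refine Iff.trans (QuotientGroup.smul_mk_eq_iff (N := N)) ⟨fun hr => ?_, fun hr => hPN hr⟩
    obtain ⟨k, hk⟩ := (isPGroup_iff_pow_pow_eq_one.1 P.isPGroup') r
    have hk' : (r : G) ^ p ^ k = 1 := congrArg Subtype.val hk
    refine P.mem_of_mem_normalizer_of_pow_eq_one (hN ▸ hr) (k := k) ?_
    have := conj_pow (i := p ^ k) (a := g⁻¹) (b := (r : G))
    rw [inv_inv] at this
    rw [this, hk']
    simp
  have hmap : (MulAction.stabilizer (P : Subgroup G) (g : G ⧸ N)).map (P : Subgroup G).subtype =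
      (P ⊓ (g • P : Sylow p G) : Subgroup G) := by
    ext x
    constructor
    · rintro ⟨r, hr, rfl⟩
      exact ⟨r.2, (hmem r).1 hr⟩
    · rintro ⟨hx, hx'⟩
      exact ⟨⟨x, hx⟩, (hmem _).2 hx', rfl⟩
  have hne : MulAction.stabilizer (P : Subgroup G) (g : G ⧸ N) ≠ ⊤ := by
    intro htop
    refine hg (hN ▸ Sylow.smul_eq_iff_mem_normalizer.1 (Sylow.eq_of_le fun x hx => ?_).symm)
    exact (hmem ⟨x, hx⟩).1 (htop ▸ Subgroup.mem_top _)
  by_cases hZ : Subgroup.upperCentralSeries P (p - 1) <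
      MulAction.stabilizer (P : Subgroup G) (g : G ⧸ N)
  · have hZ' : (Subgroup.upperCentralSeries P (p - 1)).map (P : Subgroup G).subtype <
        (P ⊓ (g • P : Sylow p G) : Subgroup G) := by
      rw [← hmap]
      exact (Subgroup.map_lt_map_iff_of_injective (P : Subgroup G).subtype_injective).2 hZ
    obtain ⟨c, hc, hcg⟩ := P.exists_centralizer_smul_eq _ h _ _ rfl hZ'
    have hn : c⁻¹ * g ∈ N := by
      rw [hN]
      exact Sylow.smul_eq_iff_mem_normalizer.1 (by rw [mul_smul, ← hcg, inv_smul_smul])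
    have hφ : ∀ r : MulAction.stabilizer (P : Subgroup G) (g : G ⧸ N),
        φ.conjStabilizer (P : Subgroup G) g r = φ ⟨(r : (P : Subgroup G)), hPN r.1.2⟩ := by
      intro r
      have hcr : ((r : (P : Subgroup G)) : G) * c = c * (r : (P : Subgroup G)) :=
        Subgroup.mem_centralizer_iff.1 hc _ ⟨r.1.2, (hmem r).1 r.2⟩
      have e : (⟨_, Subgroup.inv_mul_mul_mem_of_mem_stabilizer r⟩ : N) =
          ⟨_, hn⟩⁻¹ * ⟨(r : (P : Subgroup G)), hPN r.1.2⟩ * ⟨_, hn⟩ := by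
        ext
        change g⁻¹ * _ * g = (c⁻¹ * g)⁻¹ * _ * (c⁻¹ * g)
        have : ((r : (P : Subgroup G)) : G) = c * (r : (P : Subgroup G)) * c⁻¹ := by
          rw [← hcr, mul_inv_cancel_right]
        nth_rewrite 1 [this]
        group
      change φ _ = _
      rw [e, map_mul, map_mul, map_inv, mul_comm, mul_inv_cancel_left]
    have hnil := P.isPGroup'.isNilpotent
    obtain ⟨x, hx, hxR, hxp⟩ := P.isPGroup'.exists_mem_notMem_pow_mem (not_le_of_gt
      (Group.normalizerCondition_of_isNilpotent _ (lt_top_iff_ne_top.2 hne)))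
    refine φ.prod_conjExtendQuot_orbit (P : Subgroup G) u g hx hxR hxp fun r => ?_
    -- every factor equals `φ r`, and the product of `p` equal elements of `A` is trivial
    refine (Finset.prod_eq_pow_card (b := φ ⟨(r : (P : Subgroup G)), hPN r.1.2⟩)
      fun i _ => ?_).trans (by rw [Finset.card_range, hA])
    rw [hφ]
    have e : (⟨_, hPN ((Subgroup.conjOfMemNormalizer _ hx)^[i] r).1.2⟩ : N) =
        ⟨(x : G) ^ i, hPN (pow_mem x.2 i)⟩⁻¹ * ⟨(r : (P : Subgroup G)), hPN r.1.2⟩ *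
          ⟨(x : G) ^ i, hPN (pow_mem x.2 i)⟩ := by
      ext
      simp [Subgroup.coe_conjOfMemNormalizer_iterate]
    rw [e, map_mul, map_mul, map_inv, mul_comm, mul_inv_cancel_left]
  · obtain ⟨x, hx, hxR, hxp, hD⟩ :=
      P.isPGroup'.exists_normalizer_iterate_twistDiff_eq_one (A := A) hne hZ
    exact φ.prod_conjExtendQuot_orbit (P : Subgroup G) u g hx hxR hxp
      (MonoidHom.prod_iterate_eq_one hA _ _ (hD _))

/-- The transfer of a nontrivial homomorphism `φ` from the normalizer of `P` to a group of exponent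
`p` is nontrivial: it does not vanish at an element `u` of smallest order among those of `P` outside
the kernel of `φ`. -/
theorem Sylow.exists_transfer_ne_one (P : Sylow p G) {N : Subgroup G}
    (hN : N = Subgroup.normalizer ((P : Subgroup G) : Set G)) (hA : ∀ a : A, a ^ p = 1)
    (h : ∀ Q : Sylow p G, PTransfer.IsTameIntersection P Q →
      (Subgroup.upperCentralSeries P (p - 1)).map (P : Subgroup G).subtype < (P ⊓ Q : Subgroup G) →
      (P ⊓ Q : Subgroup G) < P →
      PTransfer.IsPNilpotent p (Subgroup.normalizer ((P ⊓ Q : Subgroup G) : Set G)))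
    {φ : N →* A} (hφ : φ ≠ 1) :
    ∃ u, MonoidHom.transfer φ u ≠ 1 := by
  classical
  have hPN : (P : Subgroup G) ≤ N := hN ▸ Subgroup.le_normalizer
  have hex : ∃ n, ∃ u : N, (u : G) ∈ P ∧ φ u ≠ 1 ∧ orderOf (u : G) = n := by
    obtain ⟨u, hu, hu'⟩ := P.exists_apply_ne_one hN hA hφ
    exact ⟨_, u, hu, hu', rfl⟩
  obtain ⟨⟨u, huN⟩, hu, hφu, hord⟩ := Nat.find_spec hex
  have hmin : ∀ w : N, (w : G) ∈ P → orderOf (w : G) < orderOf u → φ w = 1 := by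
    intro w hw hlt
    by_contra hne
    exact Nat.find_min hex (hord ▸ hlt) ⟨w, hw, hne, rfl⟩
  refine ⟨u, ?_⟩
  have : Fintype (G ⧸ N) := Fintype.ofFinite _
  have horbit : ∀ q : G ⧸ N, Fintype ((P : Subgroup G) ⧸ MulAction.stabilizer (P : Subgroup G) q) :=
    fun q => Fintype.ofFinite _
  rw [φ.transfer_eq_prod_conjExtendQuot]
  · -- the coset `N` contributes `φ u`, and each other `P`-orbit contributes `1`
    rw [← Finset.mul_prod_erase Finset.univ _ (Finset.mem_univ ((1 : G) : G ⧸ N))]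
    have h1 : φ.conjExtendQuot u ((1 : G) : G ⧸ N) = φ ⟨u, huN⟩ := by
      rw [φ.conjExtendQuot_mk, φ.conjExtend_of_mem (by simpa using huN)]
      congr 2
      simp
    rw [h1]
    suffices hrest : ∏ q ∈ Finset.univ.erase ((1 : G) : G ⧸ N), φ.conjExtendQuot u q = 1 by
      rwa [hrest, mul_one]
    refine Finset.prod_cancels_of_partition_cancels
      (MulAction.orbitRel (P : Subgroup G) (G ⧸ N)) fun q hq => ?_
    induction q using QuotientGroup.induction_on with | H g => ?_
    have hfix : ∀ s : (P : Subgroup G), s • ((1 : G) : G ⧸ N) = ((1 : G) : G ⧸ N) := by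
      intro s
      refine QuotientGroup.smul_mk_eq_iff.2 ?_
      simpa using hPN s.2
    have hg : g ∉ N := by
      intro hg
      refine (Finset.mem_erase.1 hq).1 ?_
      rw [eq_comm, QuotientGroup.eq]
      simpa using hg
    rw [← P.prod_conjExtendQuot_orbit_eq_one hN hA h φ ⟨u, hu⟩ hg]
    symm
    refine Finset.prod_bij
      (fun y _ => MulAction.ofQuotientStabilizer (P : Subgroup G) (g : G ⧸ N) y) ?_ ?_ ?_ ?_
    · intro y _
      induction y using QuotientGroup.induction_on with | H s => ?_
      rw [Finset.mem_filter, Finset.mem_erase]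
      refine ⟨⟨fun he => (Finset.mem_erase.1 hq).1 ?_, Finset.mem_univ _⟩, ⟨s, rfl⟩⟩
      rw [MulAction.ofQuotientStabilizer_mk] at he
      rw [← hfix s, smul_left_cancel_iff] at he
      exact he
    · intro y _ z _ he
      exact MulAction.injective_ofQuotientStabilizer _ _ he
    · intro q' hq'
      obtain ⟨s, hs⟩ := (Finset.mem_filter.1 hq').2
      exact ⟨(s : (P : Subgroup G) ⧸ MulAction.stabilizer (P : Subgroup G) (g : G ⧸ N)),
        Finset.mem_univ _, hs⟩
    · intro y _
      rfl
  · -- a conjugate in `N` of a proper power of `u` is in `P` and has smaller order than `u`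
    intro k g hk hdvd hk1
    obtain ⟨m, hm⟩ := (IsPGroup.iff_orderOf.1 P.isPGroup') ⟨u, hu⟩
    rw [Subgroup.orderOf_mk] at hm
    have hpos : 0 < orderOf u := orderOf_pos u
    have hk0 : k ≠ 0 := by
      rintro rfl
      exact hpos.ne' (zero_dvd_iff.1 hdvd)
    have hconj : g⁻¹ * u ^ k * g = MulAut.conj g⁻¹ (u ^ k) := by simp
    have hpow : (g⁻¹ * u ^ k * g) ^ p ^ m = 1 := by
      rw [hconj, ← map_pow, ← pow_mul, mul_comm, pow_mul, ← hm, pow_orderOf_eq_one, one_pow,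
        map_one]
    refine hmin ⟨_, hk⟩ (P.mem_of_mem_normalizer_of_pow_eq_one (hN ▸ hk) hpow) ?_
    change orderOf (g⁻¹ * u ^ k * g) < orderOf u
    rw [hconj]
    change orderOf ((MulAut.conj g⁻¹).toMonoidHom (u ^ k)) < orderOf u
    rw [orderOf_injective (MulAut.conj g⁻¹).toMonoidHom (MulAut.conj g⁻¹).injective (u ^ k)]
    rw [orderOf_pow_of_dvd hk0 hdvd]
    exact Nat.div_lt_self hpos (by omega)

end sylow

theorem mainTheorem1 {G : Type*} [Group G] [Finite G] (p : ℕ) [Fact p.Prime] (P : Sylow p G)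
    (h : ∀ Q : Sylow p G, PTransfer.IsTameIntersection P Q →
      (Subgroup.upperCentralSeries P (p - 1)).map (P : Subgroup G).subtype < (P ⊓ Q : Subgroup G) →
      (P ⊓ Q : Subgroup G) < P →
      PTransfer.IsPNilpotent p (Subgroup.normalizer ((P ⊓ Q : Subgroup G) : Set G))) :
    PTransfer.ControlsPTransfer p
      (Subgroup.normalizer ((P : Subgroup G) : Set G)) := by
  have hindex : (Subgroup.normalizer ((P : Subgroup G) : Set G)).index.Coprime p :=
    ((Nat.Prime.coprime_iff_not_dvd Fact.out).2 fun hd =>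
      P.not_dvd_index (hd.trans (Subgroup.index_dvd_of_le Subgroup.le_normalizer))).symm
  obtain ⟨_, hBp, _⟩ := PTransfer.hasAbelianPQuotient_abelianPResidual (p := p)
    (G := Subgroup.normalizer ((P : Subgroup G) : Set G))
  let _ : CommGroup (Subgroup.normalizer ((P : Subgroup G) : Set G) ⧸
      PTransfer.abelianPResidual p (Subgroup.normalizer ((P : Subgroup G) : Set G))) :=
    { mul_comm := mul_comm' }
  let π := QuotientGroup.mk'
    (PTransfer.abelianPResidual p (Subgroup.normalizer ((P : Subgroup G) : Set G)))
  refine PTransfer.controlsPTransfer_of_surjective hindex (MonoidHom.transfer π) ?_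
  rw [← MonoidHom.range_eq_top]
  -- if the transfer to `N / A^p(N)` is not onto, it vanishes in a quotient of exponent `p`
  by_contra hne
  obtain ⟨K, hle, hK, hKp⟩ := hBp.exists_le_ne_top_forall_pow_eq_one hne
  obtain ⟨u, hu⟩ := P.exists_transfer_ne_one rfl hKp h (φ := (QuotientGroup.mk' K).comp π) (by
    intro h1
    refine hK ((Subgroup.eq_top_iff' K).2 fun b => ?_)
    obtain ⟨n, rfl⟩ := QuotientGroup.mk'_surjective _ b
    exact (QuotientGroup.eq_one_iff _).1 (DFunLike.congr_fun h1 n))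
  rw [MonoidHom.transfer_comp] at hu
  exact hu ((QuotientGroup.eq_one_iff _).2 (hle ⟨u, rfl⟩))
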